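/- **Setting.** Let $M\ge 2$, let $\Omega\subset\mathbb R^M$ be open and bounded, and let $\Omega_1\subseteq\Omega$ be open, connected and with Lipschitz boundary; let $ds$ be the surface measure on $\partial\Omega_1$. In boundary integrals, functions of $H^1(\Omega_1)$ are read as their traces. Let $\gamma>0$, $0<\underline a<\overline a$, $\overline b>0$ be constants, and let $C_F>0$ be a constant in the Friedrichs inequality $$\|v\|_{H^1(\Omega_1)}^2\le C_F\Big[\int_{\Omega_1}|\nabla v|^2\,dx+\int_{\partial\Omega_1}v^2\,ds\Big]\qquad\text{for all } v\in H^1(\Omega_1).$$ Assume $\overline b<\underline a\,\min\{1,\gamma\}/C_F$. Let $b$ be a measurable function with $0<b<\overline b$ a.e. on $\Omega$, let $f\in L^\infty(\Omega)$ and $a^*\in L^2(\Omega)$. Let $\mathbb A$ be the set of functions $a$ on $\Omega\cup\partial\Omega_1$ that are measurable with respect to Lebesgue measure on $\Omega$ and to surface measure on $\partial\Omega_1$ and satisfy $\underline a\le a\le\overline a$ almost everywhere for both measures (the boundary values of $a$ on $\partial\Omega_1$ are part of $a$). For $a\in\mathbb A$ let $U(a)\in H^1(\Omega_1)$ be the weak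 solution of $-\operatorname{div}(a\nabla u)-bu=f$ in $\Omega_1$, $\nabla u\cdot\vec n+\gamma u=0$ on $\partial\Omega_1$, that is, $$\int_{\Omega_1}a\nabla u\cdot\nabla v\,dx+\int_{\partial\Omega_1}a\gamma uv\,ds-\int_{\Omega_1}buv\,dx=\int_{\Omega_1}fv\,dx\qquad\text{for all } v\in H^1(\Omega_1).$$ For $z^\delta\in H^1(\Omega_1)$ put $$G_{z^\delta}(a)=\frac12\int_{\Omega_1}a|\nabla[U(a)-z^\delta]|^2dx+\frac12\int_{\partial\Omega_1}a\gamma[U(a)-z^\delta]^2ds-\frac12\int_{\Omega_1}b[U(a)-z^\delta]^2dx .$$ **Theorem 2.1.** For every $a\in\mathbb A$ the weak solution $U(a)$ exists and is unique. For every $\rho>0$ and every $z^\delta\in H^1(\Omega_1)$ the problem $$\min_{a\in\mathbb A}\; G_{z^\delta}(a)+\rho\|a-a^*\|_{L^2(\Omega)}^2$$ has a solution $a^\delta_\rho\in\mathbb A$, and it is unique as an element of $L^2(\Omega)$: any two minimizers agree almost everywhere on $\Omega$. -/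

import Mathlib

open MeasureTheory Filter Topology Set
open scoped ENNReal ContDiff RealInnerProductSpace Gradient

noncomputable section

namespace RobinInverse

/-- The Euclidean space `ℝ^M`. -/
abbrev E (M : ℕ) := EuclideanSpace ℝ (Fin M)

variable {M : ℕ}

/-- The boundary of `Ω` is Lipschitz: near each boundary point, `Ω` is the strict epigraph, in some
direction `ν`, of a Lipschitz function `ψ` of the component orthogonal to `ν`. -/
def HasLipschitzBoundary (Ω : Set (E M)) : Prop :=
  ∀ x₀ ∈ frontier Ω, ∃ r > 0, ∃ ν : E M, ‖ν‖ = 1 ∧ ∃ K, ∃ ψ : E M → ℝ,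
    LipschitzWith K ψ ∧ (∀ (x : E M) (t : ℝ), ψ (x + t • ν) = ψ x) ∧
    ∀ x ∈ Metric.ball x₀ r, (x ∈ Ω ↔ ψ x < ⟪ν, x⟫)

/-- The surface measure on `∂Ω`: the `(M-1)`-dimensional Hausdorff measure, normalised to agree with
Lebesgue measure in dimension `M-1`, restricted to `∂Ω`. -/
def surface (Ω : Set (E M)) : Measure (E M) :=
  (Measure.euclideanHausdorffMeasure (M - 1)).restrict (frontier Ω)

/-- `p` is the weak gradient of `u` on `Ω` (both are square integrable). -/
def IsWeakGradient (Ω : Set (E M)) (u : Lp ℝ 2 (volume.restrict Ω))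
    (p : Lp (E M) 2 (volume.restrict Ω)) : Prop :=
  ∀ φ : E M → ℝ, ContDiff ℝ ∞ φ → HasCompactSupport φ → tsupport φ ⊆ Ω →
    ∀ i : Fin M, ∫ x in Ω, u x * (∇ φ x) i = - ∫ x in Ω, (p x) i * φ x

theorem continuous_gradient {φ : E M → ℝ} (h : ContDiff ℝ ∞ φ) : Continuous (∇ φ) :=
  (InnerProductSpace.toDual ℝ (E M)).symm.continuous.comp
    (h.continuous_fderiv (by simp))

theorem hasCompactSupport_gradient {φ : E M → ℝ} (h : HasCompactSupport φ) :
    HasCompactSupport (∇ φ) :=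
  (h.fderiv (𝕜 := ℝ)).comp_left (g := (InnerProductSpace.toDual ℝ (E M)).symm) (map_zero _)

theorem integrable_mul_test (Ω : Set (E M)) {u : E M → ℝ} (hu : MemLp u 2 (volume.restrict Ω))
    {g : E M → ℝ} (hg : Continuous g) (hc : HasCompactSupport g) :
    Integrable (fun x => u x * g x) (volume.restrict Ω) :=
  hu.integrable_mul (q := 2) (hg.memLp_of_hasCompactSupport hc)

theorem memLp_coord (Ω : Set (E M)) (p : Lp (E M) 2 (volume.restrict Ω)) (i : Fin M) :
    MemLp (fun x => (p x) i) 2 (volume.restrict Ω) :=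
  (EuclideanSpace.proj (𝕜 := ℝ) i).comp_memLp' (Lp.memLp p)

/-- The Sobolev space `H¹(Ω)`: pairs `(u, ∇u)` in `L² × L²`, with the norm
`‖u‖² = ‖u‖²_{L²} + ‖∇u‖²_{L²}`. -/
def H1 (Ω : Set (E M)) :
    Submodule ℝ (WithLp 2 (Lp ℝ 2 (volume.restrict Ω) × Lp (E M) 2 (volume.restrict Ω))) where
  carrier := {w | IsWeakGradient Ω w.fst w.snd}
  zero_mem' := by
    intro φ h1 h2 h3 i
    have e1 : ∫ x in Ω, (0 : Lp ℝ 2 (volume.restrict Ω)) x * (∇ φ x) i = 0 := by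
      apply integral_eq_zero_of_ae
      filter_upwards [Lp.coeFn_zero ℝ 2 (volume.restrict Ω)] with x hx
      rw [hx]
      simp
    have e2 : ∫ x in Ω, ((0 : Lp (E M) 2 (volume.restrict Ω)) x) i * φ x = 0 := by
      apply integral_eq_zero_of_ae
      filter_upwards [Lp.coeFn_zero (E M) 2 (volume.restrict Ω)] with x hx
      rw [hx]
      simp
    simp only [WithLp.zero_fst, WithLp.zero_snd]
    rw [e1, e2, neg_zero]
  add_mem' := by
    intro v w hv hw φ h1 h2 h3 i
    have hgc : Continuous fun x => (∇ φ x) i :=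
      (EuclideanSpace.proj (𝕜 := ℝ) i).continuous.comp (continuous_gradient h1)
    have hgs : HasCompactSupport fun x => (∇ φ x) i :=
      (hasCompactSupport_gradient h2).comp_left (g := fun y : E M => y i) rfl
    have e1 : ∫ x in Ω, (v.fst + w.fst) x * (∇ φ x) i
        = (∫ x in Ω, v.fst x * (∇ φ x) i) + ∫ x in Ω, w.fst x * (∇ φ x) i := by
      rw [← integral_add (integrable_mul_test Ω (Lp.memLp v.fst) hgc hgs)
        (integrable_mul_test Ω (Lp.memLp w.fst) hgc hgs)]
      apply integral_congr_ae
      filter_upwards [Lp.coeFn_add v.fst w.fst] with x hx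
      rw [hx]
      simp [add_mul]
    have e2 : ∫ x in Ω, ((v.snd + w.snd) x) i * φ x
        = (∫ x in Ω, (v.snd x) i * φ x) + ∫ x in Ω, (w.snd x) i * φ x := by
      rw [← integral_add (integrable_mul_test Ω (memLp_coord Ω v.snd i) h1.continuous h2)
        (integrable_mul_test Ω (memLp_coord Ω w.snd i) h1.continuous h2)]
      apply integral_congr_ae
      filter_upwards [Lp.coeFn_add v.snd w.snd] with x hx
      rw [hx]
      simp [add_mul]
    simp only [WithLp.add_fst, WithLp.add_snd]
    rw [e1, e2, hv φ h1 h2 h3 i, hw φ h1 h2 h3 i]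
    ring
  smul_mem' := by
    intro c v hv φ h1 h2 h3 i
    have e1 : ∫ x in Ω, (c • v.fst) x * (∇ φ x) i = c * ∫ x in Ω, v.fst x * (∇ φ x) i := by
      rw [← integral_const_mul]
      apply integral_congr_ae
      filter_upwards [Lp.coeFn_smul c v.fst] with x hx
      rw [hx]
      simp [mul_assoc]
    have e2 : ∫ x in Ω, ((c • v.snd) x) i * φ x = c * ∫ x in Ω, (v.snd x) i * φ x := by
      rw [← integral_const_mul]
      apply integral_congr_ae
      filter_upwards [Lp.coeFn_smul c v.snd] with x hx
      rw [hx]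
      simp [mul_assoc]
    simp only [WithLp.smul_fst, WithLp.smul_snd]
    rw [e1, e2, hv φ h1 h2 h3 i]
    ring

/-- `g ∈ L²(∂Ω)` is the trace of `v ∈ H¹(Ω)`: there are smooth functions `φₙ` on `ℝ^M` with
`φₙ → v` in `H¹(Ω)` and `φₙ|_{∂Ω} → g` in `L²(∂Ω)`. -/
def IsTrace (Ω : Set (E M)) (v : H1 Ω) (g : Lp ℝ 2 (surface Ω)) : Prop :=
  ∃ φ : ℕ → E M → ℝ, (∀ n, ContDiff ℝ ∞ (φ n)) ∧
    Tendsto (fun n => eLpNorm (fun x => φ n x - v.1.fst x) 2 (volume.restrict Ω)) atTop (𝓝 0) ∧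
    Tendsto (fun n => eLpNorm (fun x => ∇ (φ n) x - v.1.snd x) 2 (volume.restrict Ω))
      atTop (𝓝 0) ∧
    Tendsto (fun n => eLpNorm (fun x => φ n x - g x) 2 (surface Ω)) atTop (𝓝 0)

/-- An `H¹(Ω)` function together with its trace on `∂Ω`, that is, a point of the graph of the trace
operator `H¹(Ω) → L²(∂Ω)`. On a bounded Lipschitz domain each `H¹` function has exactly one trace,
so that this is `H¹(Ω)` itself, in a form where the boundary values can be written down. -/
@[ext]
structure H1Tr (Ω : Set (E M)) where
  toH1 : H1 Ω
  /-- the boundary values -/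
  tr : Lp ℝ 2 (surface Ω)
  isTrace : IsTrace Ω toH1 tr

/-- The function `v ∈ L²(Ω)`. -/
def H1Tr.val {Ω : Set (E M)} (v : H1Tr Ω) : Lp ℝ 2 (volume.restrict Ω) := v.toH1.1.fst

/-- The weak gradient `∇v ∈ L²(Ω; ℝ^M)`. -/
def H1Tr.grad {Ω : Set (E M)} (v : H1Tr Ω) : Lp (E M) 2 (volume.restrict Ω) := v.toH1.1.snd

instance (Ω : Set (E M)) : Nonempty (H1Tr Ω) := by
  refine ⟨⟨0, 0, fun _ _ => 0, fun _ => contDiff_const, ?_, ?_, ?_⟩⟩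
  · have h : eLpNorm (fun x => (0 : ℝ) - (0 : H1 Ω).1.fst x) 2 (volume.restrict Ω) = 0 := by
      apply eLpNorm_eq_zero_of_ae_zero
      filter_upwards [Lp.coeFn_zero ℝ 2 (volume.restrict Ω)] with x hx
      change (0 : ℝ) - (0 : Lp ℝ 2 (volume.restrict Ω)) x = 0
      rw [hx]; simp
    simp only [h]; exact tendsto_const_nhds
  · have h : eLpNorm (fun x => ∇ (fun _ : E M => (0 : ℝ)) x - (0 : H1 Ω).1.snd x) 2
        (volume.restrict Ω) = 0 := by
      apply eLpNorm_eq_zero_of_ae_zero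
      filter_upwards [Lp.coeFn_zero (E M) 2 (volume.restrict Ω)] with x hx
      change ∇ (fun _ : E M => (0 : ℝ)) x - (0 : Lp (E M) 2 (volume.restrict Ω)) x = 0
      rw [hx]; simp [gradient]
    simp only [h]; exact tendsto_const_nhds
  · have h : eLpNorm (fun x => (0 : ℝ) - (0 : Lp ℝ 2 (surface Ω)) x) 2 (surface Ω) = 0 := by
      apply eLpNorm_eq_zero_of_ae_zero
      filter_upwards [Lp.coeFn_zero ℝ 2 (surface Ω)] with x hx
      rw [hx]
      simp
    simp only [h]; exact tendsto_const_nhds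

/-- The admissible coefficients: functions with `lo ≤ a ≤ hi` almost everywhere, both for Lebesgue
measure on `Ω` and for surface measure on `∂Ω₁`, where the boundary condition uses their values. -/
def admissible (Ω Ω₁ : Set (E M)) (lo hi : ℝ) : Set (E M → ℝ) :=
  {a | AEMeasurable a (volume.restrict Ω) ∧ AEMeasurable a (surface Ω₁) ∧
    (∀ᵐ x ∂(volume.restrict Ω), lo ≤ a x ∧ a x ≤ hi) ∧
    ∀ᵐ x ∂(surface Ω₁), lo ≤ a x ∧ a x ≤ hi}

/-- `u` is a weak solution in `H¹(Ω₁)` of `-div(a∇u) - bu = f` in `Ω₁`, `∇u·n + γu = 0` on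
`∂Ω₁`. -/
def IsWeakSolution (Ω₁ : Set (E M)) (γ : ℝ) (b f a : E M → ℝ) (u : H1Tr Ω₁) : Prop :=
  ∀ v : H1Tr Ω₁,
    (∫ x in Ω₁, a x * ⟪u.grad x, v.grad x⟫) + (∫ x, a x * γ * u.tr x * v.tr x ∂(surface Ω₁))
      - (∫ x in Ω₁, b x * u.val x * v.val x) = ∫ x in Ω₁, f x * v.val x

/-- The coefficient-to-solution operator `a ↦ U(a)`: the weak solution if there is one. -/
def U (Ω₁ : Set (E M)) (γ : ℝ) (b f a : E M → ℝ) : H1Tr Ω₁ :=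
  Classical.epsilon (IsWeakSolution Ω₁ γ b f a)

/-- The energy functional `G_z(a)`. -/
def G (Ω₁ : Set (E M)) (γ : ℝ) (b f : E M → ℝ) (z : H1Tr Ω₁) (a : E M → ℝ) : ℝ :=
  1 / 2 * (∫ x in Ω₁, a x * ‖(U Ω₁ γ b f a).grad x - z.grad x‖ ^ 2)
  + 1 / 2 * (∫ x, a x * γ * ((U Ω₁ γ b f a).tr x - z.tr x) ^ 2 ∂(surface Ω₁))
  - 1 / 2 * (∫ x in Ω₁, b x * ((U Ω₁ γ b f a).val x - z.val x) ^ 2)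

/-- The Tikhonov functional `G_z(a) + ρ ‖a - a*‖²_{L²(Ω)}`. -/
def tikhonov (Ω Ω₁ : Set (E M)) (γ : ℝ) (b f : E M → ℝ) (z : H1Tr Ω₁) (ρ : ℝ)
    (aStar a : E M → ℝ) : ℝ :=
  G Ω₁ γ b f z a + ρ * ∫ x in Ω, (a x - aStar x) ^ 2

end RobinInverse

end

/-!
The weak formulation is solved with the Lax-Milgram lemma on the graph of the trace operator, which
is a closed subspace of `L² × L² × L²(∂Ω₁)`: `H¹` is closed (`isClosed_H1`), and the condition to
have a given trace is membership in the closure of the smooth functions (`isTrace_iff`). The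
Friedrichs inequality controls the `H¹` norm by the gradient and the boundary values, so the bound
on `b` makes the bilinear form `A_a` of the problem coercive in the graph norm, boundary values
included (`isCoercive_robinForm`). The trace theorem is not needed.

Let `u = U(a)` and let `L` be the load. Since `A_a` is symmetric and `A_a(u, ·) = L`, the energy
`G_z(a) = A_a(u - z, u - z) / 2` exceeds
`L(v) - A_a(v, v) / 2 - L(z) + A_a(z, z) / 2` by `A_a(u - v, u - v) / 2 ≥ 0` for every `v`. So `G_z`
is a pointwise maximum of functionals that are affine in `a` (`G_isGreatest`), and the Tikhonov
functional is a maximum of functionals with the strongly convex part `ρ ‖a - a*‖²`.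

The surface measure of the boundary is finite (`isFiniteMeasure_surface`), so the admissible
coefficients are the functions with values in `[lo, hi]` in `L²` of one finite measure, the sum of
Lebesgue measure on `Ω` and surface measure on `∂Ω₁` (`admissible_eq`). There the sublevel sets of
the Tikhonov functional are closed, convex and bounded, and a decreasing sequence of such sets in a
Hilbert space has a common point (`nonempty_iInter_of_antitone_convex`), which is a minimizer. At
the midpoint of two minimizers, strong convexity of the minorant that touches the functional there
forces the two to agree almost everywhere on `Ω` (`ae_eq_of_isMinOn`).
-/


noncomputable section

namespace RobinInverse

/-! ### Decreasing sequences of convex sets in a Hilbert space -/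

/-- In a Hilbert space a decreasing sequence of nonempty bounded closed convex sets has a common
point: the points of least norm form a Cauchy sequence by the parallelogram law. -/
theorem nonempty_iInter_of_antitone_convex {H : Type*} [NormedAddCommGroup H]
    [InnerProductSpace ℝ H] [CompleteSpace H] {C : ℕ → Set H} (hanti : Antitone C)
    (hne : ∀ n, (C n).Nonempty) (hcl : ∀ n, IsClosed (C n)) (hcv : ∀ n, Convex ℝ (C n))
    {R : ℝ} (hR : ∀ x ∈ C 0, ‖x‖ ≤ R) : (⋂ n, C n).Nonempty := by
  have hmin : ∀ n, ∃ x ∈ C n, ∀ y ∈ C n, ‖x‖ ≤ ‖y‖ := by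
    intro n
    obtain ⟨x, hx, hxe⟩ :=
      exists_norm_eq_iInf_of_complete_convex (hne n) (hcl n).isComplete (hcv n) 0
    refine ⟨x, hx, fun y hy => ?_⟩
    have h := ciInf_le (f := fun w : C n => ‖(0 : H) - w‖)
      ⟨0, Set.forall_mem_range.2 fun _ => norm_nonneg _⟩ ⟨y, hy⟩
    rw [← hxe] at h
    simpa using h
  choose x hx hxmin using hmin
  have hmono : Monotone fun n => ‖x n‖ ^ 2 := fun n m hnm => by
    have := hxmin n (x m) (hanti hnm (hx m))
    dsimp only
    gcongr
  have hbdd : BddAbove (range fun n => ‖x n‖ ^ 2) := by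
    refine ⟨R ^ 2, ?_⟩
    rintro _ ⟨n, rfl⟩
    have := hR (x n) (hanti (Nat.zero_le n) (hx n))
    dsimp only
    gcongr
  have hlim := (tendsto_atTop_ciSup hmono hbdd).cauchySeq
  have hpar : ∀ n m, n ≤ m → ‖x n - x m‖ ^ 2 ≤ 2 * (‖x m‖ ^ 2 - ‖x n‖ ^ 2) := by
    intro n m hnm
    have hmid : (1 / 2 : ℝ) • x n + (1 / 2 : ℝ) • x m ∈ C n :=
      hcv n (hx n) (hanti hnm (hx m)) (by norm_num) (by norm_num) (by norm_num)
    have h1 := hxmin n _ hmid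
    rw [← smul_add, norm_smul] at h1
    have h2 := parallelogram_law_with_norm ℝ (x n) (x m)
    have h3 : 2 * ‖x n‖ ≤ ‖x n + x m‖ := by
      norm_num at h1
      linarith
    have h4 : (2 * ‖x n‖) ^ 2 ≤ ‖x n + x m‖ ^ 2 := by gcongr
    nlinarith
  have hcauchy : CauchySeq x := by
    rw [Metric.cauchySeq_iff'] at hlim ⊢
    intro ε hε
    obtain ⟨N, hN⟩ := hlim (ε ^ 2 / 2) (by positivity)
    refine ⟨N, fun n hn => ?_⟩
    have h1 := hN n hn
    rw [Real.dist_eq] at h1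
    have h2 := hpar N n hn
    have h3 := le_abs_self (‖x n‖ ^ 2 - ‖x N‖ ^ 2)
    rw [dist_comm, dist_eq_norm]
    exact lt_of_pow_lt_pow_left₀ 2 hε.le (by linarith)
  obtain ⟨y, hy⟩ := cauchySeq_tendsto_of_complete hcauchy
  refine ⟨y, mem_iInter.2 fun n => (hcl n).mem_of_tendsto hy ?_⟩
  filter_upwards [eventually_ge_atTop n] with m hm using hanti hm (hx m)

/-! ### Finiteness of the surface measure -/

variable {M : ℕ}

/-- A bounded piece of the graph, over the hyperplane orthogonal to `ν`, of a Lipschitz function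
has finite `(M - 1)`-dimensional measure. -/
theorem euclideanHausdorffMeasure_graph_lt_top (hM : 1 ≤ M) {ν : E M} (hν : ‖ν‖ = 1) {K : NNReal}
    {ψ : E M → ℝ} (hψ : LipschitzWith K ψ) (hinv : ∀ (x : E M) (t : ℝ), ψ (x + t • ν) = ψ x)
    {S : Set (E M)} (hS : Bornology.IsBounded S) (hgraph : ∀ x ∈ S, ⟪ν, x⟫ = ψ x) :
    Measure.euclideanHausdorffMeasure (M - 1) S < ⊤ := by
  have hν0 : ν ≠ 0 := by
    rintro rfl
    simp at hν
  let V := (Submodule.span ℝ {ν})ᗮ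
  have hV : Module.finrank ℝ V = M - 1 := by
    have : Fact (Module.finrank ℝ (E M) = (M - 1) + 1) :=
      ⟨by rw [finrank_euclideanSpace_fin]; omega⟩
    exact Submodule.finrank_orthogonal_span_singleton hν0
  obtain ⟨R, hR⟩ := hS.exists_norm_le
  let F : V → E M := fun y => (y : E M) + ψ (y : E M) • ν
  have hF : LipschitzWith (1 + K) F := by
    have h1 : LipschitzWith 1 (fun y : V => (y : E M)) := LipschitzWith.subtype_val _
    have h2 : LipschitzWith K (fun y : V => ψ (y : E M) • ν) := by
      refine LipschitzWith.of_dist_le_mul fun y y' => ?_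
      rw [dist_eq_norm, ← sub_smul, norm_smul, hν, mul_one, ← dist_eq_norm]
      exact hψ.dist_le_mul _ _
    exact h1.add h2
  have hsub : S ⊆ F '' Metric.closedBall 0 R := by
    intro x hx
    have hmem : x - ⟪ν, x⟫ • ν ∈ V := by
      rw [Submodule.mem_orthogonal_singleton_iff_inner_right, inner_sub_right, inner_smul_right,
        real_inner_self_eq_norm_sq, hν]
      ring
    refine ⟨⟨x - ⟪ν, x⟫ • ν, hmem⟩, ?_, ?_⟩
    · rw [mem_closedBall_zero_iff]
      refine le_trans ?_ (hR x hx)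
      change ‖x - ⟪ν, x⟫ • ν‖ ≤ ‖x‖
      refine le_of_sq_le_sq ?_ (norm_nonneg _)
      rw [norm_sub_sq_real, norm_smul, inner_smul_right, hν, real_inner_comm, mul_one,
        Real.norm_eq_abs, sq_abs]
      nlinarith [sq_nonneg ⟪ν, x⟫]
    · change x - ⟪ν, x⟫ • ν + ψ (x - ⟪ν, x⟫ • ν) • ν = x
      rw [sub_eq_add_neg, ← neg_smul, hinv, hgraph x hx]
      simp
  have hball : Measure.euclideanHausdorffMeasure (M - 1) (Metric.closedBall (0 : V) R) < ⊤ := by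
    rw [← hV, InnerProductSpace.euclideanHausdorffMeasure_eq_volume]
    exact measure_closedBall_lt_top
  calc Measure.euclideanHausdorffMeasure (M - 1) S
      ≤ Measure.euclideanHausdorffMeasure (M - 1) (F '' Metric.closedBall 0 R) :=
        measure_mono hsub
    _ ≤ ((1 + K : NNReal) : ℝ≥0∞) ^ ((M - 1 : ℕ) : ℝ) *
        Measure.euclideanHausdorffMeasure (M - 1) (Metric.closedBall (0 : V) R) := by
        simp only [Measure.euclideanHausdorffMeasure_def, Measure.smul_apply, ENNReal.smul_def,
          smul_eq_mul]
        rw [mul_left_comm]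
        gcongr
        exact hF.hausdorffMeasure_image_le (Nat.cast_nonneg _) _
    _ < ⊤ := ENNReal.mul_lt_top
        (ENNReal.rpow_lt_top_of_nonneg (Nat.cast_nonneg _) ENNReal.coe_ne_top) hball

/-- A Lipschitz boundary is locally the graph of the Lipschitz function whose epigraph is the
domain. -/
theorem inner_eq_of_mem_frontier {Ω : Set (E M)} (hΩ : IsOpen Ω) {x₀ : E M} {r : ℝ} {ν : E M}
    {K : NNReal} {ψ : E M → ℝ} (hψ : LipschitzWith K ψ)
    (h : ∀ x ∈ Metric.ball x₀ r, (x ∈ Ω ↔ ψ x < ⟪ν, x⟫)) {x : E M} (hx : x ∈ frontier Ω)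
    (hxr : x ∈ Metric.ball x₀ r) : ⟪ν, x⟫ = ψ x := by
  rw [hΩ.frontier_eq] at hx
  refine le_antisymm (not_lt.1 fun hlt => hx.2 ((h x hxr).2 hlt)) ?_
  have hcl : x ∈ closure (Metric.ball x₀ r ∩ Ω) :=
    Metric.isOpen_ball.inter_closure ⟨hxr, hx.1⟩
  have hclosed : IsClosed {y : E M | ψ y ≤ ⟪ν, y⟫} :=
    isClosed_le hψ.continuous (by fun_prop)
  exact closure_minimal (fun y hy => ((h y hy.1).1 hy.2).le) hclosed hcl

/-- The boundary of a bounded Lipschitz domain has finite surface measure. -/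
theorem isFiniteMeasure_surface (hM : 1 ≤ M) {Ω : Set (E M)} (hΩ : IsOpen Ω)
    (hb : Bornology.IsBounded Ω) (hLip : HasLipschitzBoundary Ω) :
    IsFiniteMeasure (surface Ω) := by
  refine ⟨?_⟩
  rw [surface, Measure.restrict_apply_univ]
  have hcpt : IsCompact (frontier Ω) :=
    Metric.isCompact_of_isClosed_isBounded isClosed_frontier
      (hb.closure.subset frontier_subset_closure)
  refine hcpt.measure_lt_top_of_nhdsWithin fun x₀ hx₀ => ?_
  obtain ⟨r, hr, ν, hν, K, ψ, hψ, hinv, h⟩ := hLip x₀ hx₀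
  refine ⟨frontier Ω ∩ Metric.ball x₀ r,
    inter_mem_nhdsWithin _ (Metric.ball_mem_nhds x₀ hr), ?_⟩
  exact euclideanHausdorffMeasure_graph_lt_top hM hν hψ hinv
    (Metric.isBounded_ball.subset inter_subset_right)
    fun x hx => inner_eq_of_mem_frontier hΩ hψ h hx.1 hx.2

/-! ### Closedness of `H¹` -/

/-- `H¹(Ω)` is closed in `L² × L²`: it is cut out by the equations that define the weak gradient,
each of which equates two continuous functionals. -/
theorem isClosed_H1 (Ω : Set (E M)) : IsClosed (H1 Ω : Set (WithLp 2
    (Lp ℝ 2 (volume.restrict Ω) × Lp (E M) 2 (volume.restrict Ω)))) := by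
  have hset : (H1 Ω : Set (WithLp 2
      (Lp ℝ 2 (volume.restrict Ω) × Lp (E M) 2 (volume.restrict Ω)))) =
      {w | IsWeakGradient Ω w.fst w.snd} := rfl
  rw [hset]
  simp only [IsWeakGradient, ofPred_forall]
  refine isClosed_iInter fun φ => isClosed_iInter fun h1 => isClosed_iInter fun h2 =>
    isClosed_iInter fun _ => isClosed_iInter fun i => ?_
  have hg : MemLp (fun x => (∇ φ x) i) 2 (volume.restrict Ω) :=
    Continuous.memLp_of_hasCompactSupport
      ((EuclideanSpace.proj (𝕜 := ℝ) i).continuous.comp (continuous_gradient h1))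
      ((hasCompactSupport_gradient h2).comp_left (g := fun y : E M => y i) rfl)
  have hφ : MemLp (fun x => φ x • EuclideanSpace.single i (1 : ℝ)) 2 (volume.restrict Ω) :=
    Continuous.memLp_of_hasCompactSupport (h1.continuous.smul continuous_const) h2.smul_right
  have e1 : ∀ u : Lp ℝ 2 (volume.restrict Ω),
      ∫ x in Ω, u x * (∇ φ x) i = ⟪hg.toLp, u⟫ := by
    intro u
    rw [L2.inner_def]
    apply integral_congr_ae
    filter_upwards [hg.coeFn_toLp] with x hx
    rw [hx]
    simp
  have e2 : ∀ p : Lp (E M) 2 (volume.restrict Ω),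
      ∫ x in Ω, (p x) i * φ x = ⟪hφ.toLp, p⟫ := by
    intro p
    rw [L2.inner_def]
    apply integral_congr_ae
    filter_upwards [hφ.coeFn_toLp] with x hx
    rw [hx, inner_smul_left, EuclideanSpace.inner_single_left]
    simp [mul_comm]
  simp only [e1, e2]
  refine isClosed_eq ?_ ?_
  · exact continuous_const.inner (WithLp.fstL 2 ℝ _ _).continuous
  · exact (continuous_const.inner (WithLp.sndL 2 ℝ _ _).continuous).neg

theorem gradient_add {φ ψ : E M → ℝ} (hφ : ContDiff ℝ ∞ φ) (hψ : ContDiff ℝ ∞ ψ) (x : E M) :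
    ∇ (φ + ψ) x = ∇ φ x + ∇ ψ x := by
  simp only [gradient]
  rw [fderiv_add (hφ.differentiable (by simp) x) (hψ.differentiable (by simp) x), map_add]

theorem gradient_const_smul {φ : E M → ℝ} (hφ : ContDiff ℝ ∞ φ) (c : ℝ) (x : E M) :
    ∇ (c • φ) x = c • ∇ φ x := by
  simp only [gradient]
  rw [fderiv_const_smul (hφ.differentiable (by simp) x)]
  simp

/-! ### The graph of the trace operator as a Hilbert space -/

/-- The triples `(φ, ∇φ, φ|_{∂Ω})` for smooth `φ` on `ℝ^M` whose entries are square integrable. -/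
def smoothTriples (Ω : Set (E M)) : Submodule ℝ (Lp ℝ 2 (volume.restrict Ω) ×
    Lp (E M) 2 (volume.restrict Ω) × Lp ℝ 2 (surface Ω)) where
  carrier := {w | ∃ φ : E M → ℝ, ContDiff ℝ ∞ φ ∧ w.1 =ᵐ[volume.restrict Ω] φ ∧
    w.2.1 =ᵐ[volume.restrict Ω] ∇ φ ∧ w.2.2 =ᵐ[surface Ω] φ}
  zero_mem' := by
    refine ⟨0, contDiff_const, Lp.coeFn_zero _ _ _, ?_, Lp.coeFn_zero _ _ _⟩
    filter_upwards [Lp.coeFn_zero (E M) 2 (volume.restrict Ω)] with x hx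
    change (0 : Lp (E M) 2 (volume.restrict Ω)) x = _
    rw [hx]
    simp [gradient]
  add_mem' := by
    rintro v w ⟨φ, hφ, h1, h2, h3⟩ ⟨ψ, hψ, k1, k2, k3⟩
    refine ⟨φ + ψ, hφ.add hψ, ?_, ?_, ?_⟩
    · filter_upwards [h1, k1, Lp.coeFn_add v.1 w.1] with x a b c
      rw [Prod.fst_add, c, Pi.add_apply, a, b, Pi.add_apply]
    · filter_upwards [h2, k2, Lp.coeFn_add v.2.1 w.2.1] with x a b c
      rw [Prod.snd_add, Prod.fst_add, c, Pi.add_apply, a, b, gradient_add hφ hψ]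
    · filter_upwards [h3, k3, Lp.coeFn_add v.2.2 w.2.2] with x a b c
      rw [Prod.snd_add, Prod.snd_add, c, Pi.add_apply, a, b, Pi.add_apply]
  smul_mem' := by
    rintro c w ⟨φ, hφ, h1, h2, h3⟩
    refine ⟨c • φ, hφ.const_smul c, ?_, ?_, ?_⟩
    · filter_upwards [h1, Lp.coeFn_smul c w.1] with x a b
      rw [Prod.smul_fst, b, Pi.smul_apply, a, Pi.smul_apply]
    · filter_upwards [h2, Lp.coeFn_smul c w.2.1] with x a b
      rw [Prod.smul_snd, Prod.smul_fst, b, Pi.smul_apply, a, gradient_const_smul hφ]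
    · filter_upwards [h3, Lp.coeFn_smul c w.2.2] with x a b
      rw [Prod.smul_snd, Prod.smul_snd, b, Pi.smul_apply, a, Pi.smul_apply]

theorem memLp_of_eLpNorm_sub_lt_top {α F : Type*} [MeasurableSpace α] {μ : Measure α}
    [NormedAddCommGroup F] {g : α → F} (hg : AEStronglyMeasurable g μ) (p : Lp F 2 μ)
    (h : eLpNorm (fun x => g x - p x) 2 μ < ⊤) : MemLp g 2 μ := by
  have h1 : MemLp (fun x => g x - p x) 2 μ := ⟨hg.sub (Lp.aestronglyMeasurable p), h⟩
  refine (h1.add (Lp.memLp p)).ae_eq (.of_forall fun x => ?_)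
  simp

/-- Traces are exactly the pairs in the closure of the smooth triples. -/
theorem isTrace_iff {Ω : Set (E M)} (v : H1 Ω) (g : Lp ℝ 2 (surface Ω)) :
    IsTrace Ω v g ↔ (v.1.fst, v.1.snd, g) ∈ (smoothTriples Ω).topologicalClosure := by
  rw [← SetLike.mem_coe, Submodule.topologicalClosure_coe, mem_closure_iff_seq_limit]
  constructor
  · rintro ⟨φ, hφ, h1, h2, h3⟩
    obtain ⟨N, hN⟩ := eventually_atTop.1 ((h1.eventually_lt_const ENNReal.zero_lt_top).and
      ((h2.eventually_lt_const ENNReal.zero_lt_top).and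
        (h3.eventually_lt_const ENNReal.zero_lt_top)))
    have m1 : ∀ n, MemLp (φ (n + N)) 2 (volume.restrict Ω) := fun n =>
      memLp_of_eLpNorm_sub_lt_top (hφ _).continuous.aestronglyMeasurable _
        (hN (n + N) (by omega)).1
    have m2 : ∀ n, MemLp (∇ (φ (n + N))) 2 (volume.restrict Ω) := fun n =>
      memLp_of_eLpNorm_sub_lt_top (continuous_gradient (hφ _)).aestronglyMeasurable _
        (hN (n + N) (by omega)).2.1
    have m3 : ∀ n, MemLp (φ (n + N)) 2 (surface Ω) := fun n =>
      memLp_of_eLpNorm_sub_lt_top (hφ _).continuous.aestronglyMeasurable _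
        (hN (n + N) (by omega)).2.2
    refine ⟨fun n => ((m1 n).toLp, (m2 n).toLp, (m3 n).toLp), fun n => ⟨φ (n + N), hφ _,
      (m1 n).coeFn_toLp, (m2 n).coeFn_toLp, (m3 n).coeFn_toLp⟩, ?_⟩
    refine Tendsto.prodMk_nhds ?_ (Tendsto.prodMk_nhds ?_ ?_)
    · rw [Lp.tendsto_Lp_iff_tendsto_eLpNorm']
      refine ((tendsto_add_atTop_iff_nat N).2 h1).congr fun n => eLpNorm_congr_ae ?_
      filter_upwards [(m1 n).coeFn_toLp] with x hx
      rw [Pi.sub_apply, hx]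
    · rw [Lp.tendsto_Lp_iff_tendsto_eLpNorm']
      refine ((tendsto_add_atTop_iff_nat N).2 h2).congr fun n => eLpNorm_congr_ae ?_
      filter_upwards [(m2 n).coeFn_toLp] with x hx
      rw [Pi.sub_apply, hx]
    · rw [Lp.tendsto_Lp_iff_tendsto_eLpNorm']
      refine ((tendsto_add_atTop_iff_nat N).2 h3).congr fun n => eLpNorm_congr_ae ?_
      filter_upwards [(m3 n).coeFn_toLp] with x hx
      rw [Pi.sub_apply, hx]
  · rintro ⟨w, hw, hlim⟩
    choose φ hφ h1 h2 h3 using hw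
    have l1 := (continuous_fst.tendsto _).comp hlim
    have l2 := ((continuous_fst.comp continuous_snd).tendsto _).comp hlim
    have l3 := ((continuous_snd.comp continuous_snd).tendsto _).comp hlim
    rw [Lp.tendsto_Lp_iff_tendsto_eLpNorm'] at l1 l2 l3
    refine ⟨φ, hφ, l1.congr fun n => eLpNorm_congr_ae ?_, l2.congr fun n => eLpNorm_congr_ae ?_,
      l3.congr fun n => eLpNorm_congr_ae ?_⟩
    · filter_upwards [h1 n] with x hx
      simp only [Pi.sub_apply, Function.comp_apply, hx]
    · filter_upwards [h2 n] with x hx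
      simp only [Pi.sub_apply, Function.comp_apply, hx]
    · filter_upwards [h3 n] with x hx
      simp only [Pi.sub_apply, Function.comp_apply, hx]

/-- The Hilbert space `(L² × L²) × L²(∂Ω)`, which contains the graph of the trace operator. It is a
type of its own because instance search is slow on the nested products. -/
def TripleSpace (Ω : Set (E M)) : Type := WithLp 2 (WithLp 2
  (Lp ℝ 2 (volume.restrict Ω) × Lp (E M) 2 (volume.restrict Ω)) × Lp ℝ 2 (surface Ω))

instance (Ω : Set (E M)) : NormedAddCommGroup (TripleSpace Ω) :=
  inferInstanceAs (NormedAddCommGroup (WithLp 2 (WithLp 2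
    (Lp ℝ 2 (volume.restrict Ω) × Lp (E M) 2 (volume.restrict Ω)) × Lp ℝ 2 (surface Ω))))

instance (Ω : Set (E M)) : InnerProductSpace ℝ (TripleSpace Ω) :=
  inferInstanceAs (InnerProductSpace ℝ (WithLp 2 (WithLp 2
    (Lp ℝ 2 (volume.restrict Ω) × Lp (E M) 2 (volume.restrict Ω)) × Lp ℝ 2 (surface Ω))))

instance (Ω : Set (E M)) : CompleteSpace (TripleSpace Ω) :=
  inferInstanceAs (CompleteSpace (WithLp 2 (WithLp 2
    (Lp ℝ 2 (volume.restrict Ω) × Lp (E M) 2 (volume.restrict Ω)) × Lp ℝ 2 (surface Ω))))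

/-- The projection to `L² × L²`. -/
def interiorL (Ω : Set (E M)) : TripleSpace Ω →L[ℝ]
    WithLp 2 (Lp ℝ 2 (volume.restrict Ω) × Lp (E M) 2 (volume.restrict Ω)) :=
  WithLp.fstL 2 ℝ _ _

/-- The projection to `L²(∂Ω)`. -/
def boundaryL (Ω : Set (E M)) : TripleSpace Ω →L[ℝ] Lp ℝ 2 (surface Ω) :=
  WithLp.sndL 2 ℝ _ _

/-- The identity map from the Hilbert space to the product of the three `L²` spaces. -/
def toTriple (Ω : Set (E M)) : TripleSpace Ω →L[ℝ]
    Lp ℝ 2 (volume.restrict Ω) × Lp (E M) 2 (volume.restrict Ω) × Lp ℝ 2 (surface Ω) :=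
  ((WithLp.fstL 2 ℝ _ _).comp (interiorL Ω)).prod
    (((WithLp.sndL 2 ℝ _ _).comp (interiorL Ω)).prod (boundaryL Ω))

/-- The graph of the trace operator as a subspace of a Hilbert space: the points of `H1Tr Ω` as a
vector space. -/
def traceGraph (Ω : Set (E M)) : Submodule ℝ (TripleSpace Ω) :=
  (H1 Ω).comap (interiorL Ω).toLinearMap ⊓
    (smoothTriples Ω).topologicalClosure.comap (toTriple Ω).toLinearMap

theorem isClosed_traceGraph (Ω : Set (E M)) : IsClosed (traceGraph Ω : Set (TripleSpace Ω)) :=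
  ((isClosed_H1 Ω).preimage (interiorL Ω).continuous).inter
    ((Submodule.isClosed_topologicalClosure _).preimage (toTriple Ω).continuous)

instance (Ω : Set (E M)) : CompleteSpace (traceGraph Ω) :=
  (isClosed_traceGraph Ω).completeSpace_coe

/-- The points of the trace graph are the elements of `H1Tr Ω`. -/
def traceGraphEquiv (Ω : Set (E M)) : traceGraph Ω ≃ H1Tr Ω where
  toFun w := ⟨⟨interiorL Ω w.1, w.2.1⟩, boundaryL Ω w.1, (isTrace_iff _ _).2 w.2.2⟩
  invFun v := ⟨WithLp.toLp 2 (v.toH1.1, v.tr), v.toH1.2, (isTrace_iff _ _).1 v.isTrace⟩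
  left_inv _ := rfl
  right_inv _ := rfl

/-- The inclusion of the trace graph into the product of the `L²` spaces, `v ↦ (v, ∇v, tr v)`. -/
def tripleL (Ω : Set (E M)) : traceGraph Ω →L[ℝ]
    Lp ℝ 2 (volume.restrict Ω) × Lp (E M) 2 (volume.restrict Ω) × Lp ℝ 2 (surface Ω) :=
  (toTriple Ω).comp (traceGraph Ω).subtypeL

/-- The function `v ∈ L²(Ω)`, as a linear map on the trace graph. -/
def valL (Ω : Set (E M)) : traceGraph Ω →L[ℝ] Lp ℝ 2 (volume.restrict Ω) :=
  (ContinuousLinearMap.fst ℝ _ _).comp (tripleL Ω)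

/-- The weak gradient `∇v ∈ L²(Ω; ℝ^M)`, as a linear map on the trace graph. -/
def gradL (Ω : Set (E M)) : traceGraph Ω →L[ℝ] Lp (E M) 2 (volume.restrict Ω) :=
  ((ContinuousLinearMap.fst ℝ _ _).comp (ContinuousLinearMap.snd ℝ _ _)).comp (tripleL Ω)

/-- The boundary values of `v`, as a linear map on the trace graph. -/
def trL (Ω : Set (E M)) : traceGraph Ω →L[ℝ] Lp ℝ 2 (surface Ω) :=
  ((ContinuousLinearMap.snd ℝ _ _).comp (ContinuousLinearMap.snd ℝ _ _)).comp (tripleL Ω)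

theorem traceGraphEquiv_val {Ω : Set (E M)} (w : traceGraph Ω) :
    (traceGraphEquiv Ω w).val = valL Ω w := rfl

theorem traceGraphEquiv_grad {Ω : Set (E M)} (w : traceGraph Ω) :
    (traceGraphEquiv Ω w).grad = gradL Ω w := rfl

theorem traceGraphEquiv_tr {Ω : Set (E M)} (w : traceGraph Ω) :
    (traceGraphEquiv Ω w).tr = trL Ω w := rfl

theorem norm_sq_traceGraph {Ω : Set (E M)} (w : traceGraph Ω) :
    ‖w‖ ^ 2 = ‖(traceGraphEquiv Ω w).toH1‖ ^ 2 + ‖trL Ω w‖ ^ 2 :=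
  WithLp.prod_norm_sq_eq_of_L2 w.1

theorem norm_sq_toH1 {Ω : Set (E M)} (w : traceGraph Ω) :
    ‖(traceGraphEquiv Ω w).toH1‖ ^ 2 = ‖valL Ω w‖ ^ 2 + ‖gradL Ω w‖ ^ 2 :=
  WithLp.prod_norm_sq_eq_of_L2 (interiorL Ω w.1)

/-! ### Weighted forms on `L²` -/

/-- The bilinear form `(p, q) ↦ ∫ a ⟪p, q⟫` on `L²` with a bounded weight `a`. -/
def weightedForm {α F : Type*} [MeasurableSpace α] {μ : Measure α} [NormedAddCommGroup F]
    [InnerProductSpace ℝ F] (a : Lp ℝ ⊤ μ) : Lp F 2 μ →L[ℝ] Lp F 2 μ →L[ℝ] ℝ :=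
  (innerSL ℝ).comp ((ContinuousLinearMap.lsmul ℝ ℝ).holderL μ ⊤ 2 2 a)

section weightedForm

variable {α F : Type*} [MeasurableSpace α] {μ : Measure α} [NormedAddCommGroup F]
  [InnerProductSpace ℝ F]

theorem weightedForm_toLp {a : α → ℝ} (ha : MemLp a ⊤ μ) (p q : Lp F 2 μ) :
    weightedForm ha.toLp p q = ∫ x, a x * ⟪p x, q x⟫ ∂μ := by
  change ⟪(ContinuousLinearMap.lsmul ℝ ℝ).holder 2 ha.toLp p, q⟫ = _
  rw [L2.inner_def]
  apply integral_congr_ae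
  filter_upwards [ContinuousLinearMap.coeFn_holder (r := 2) (ContinuousLinearMap.lsmul ℝ ℝ)
    ha.toLp p, ha.coeFn_toLp] with x h1 h2
  rw [h1, h2]
  simp [inner_smul_left]

theorem integrable_weighted_inner {a : α → ℝ} (ha : MemLp a ⊤ μ) (p q : Lp F 2 μ) :
    Integrable (fun x => a x * ⟪p x, q x⟫) μ :=
  (L2.integrable_inner p q).mul_of_top_right ha

theorem integral_norm_sq (p : Lp F 2 μ) : ∫ x, ‖p x‖ ^ 2 ∂μ = ‖p‖ ^ 2 := by
  rw [← real_inner_self_eq_norm_sq, L2.inner_def]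
  simp

theorem integrable_norm_sq (p : Lp F 2 μ) : Integrable (fun x => ‖p x‖ ^ 2) μ := by
  simpa using L2.integrable_inner (𝕜 := ℝ) p p

end weightedForm

theorem weightedForm_self_le {α F : Type*} [MeasurableSpace α] {μ : Measure α}
    [NormedAddCommGroup F] [InnerProductSpace ℝ F] {a : α → ℝ} (ha : MemLp a ⊤ μ) {C : ℝ}
    (hC : ∀ᵐ x ∂μ, a x ≤ C) (p : Lp F 2 μ) : weightedForm ha.toLp p p ≤ C * ‖p‖ ^ 2 := by
  rw [weightedForm_toLp, ← integral_norm_sq, ← integral_const_mul]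
  refine integral_mono_ae (integrable_weighted_inner ha p p)
    ((integrable_norm_sq p).const_mul C) ?_
  filter_upwards [hC] with x hx
  rw [real_inner_self_eq_norm_sq]
  gcongr

theorem le_weightedForm_self {α F : Type*} [MeasurableSpace α] {μ : Measure α}
    [NormedAddCommGroup F] [InnerProductSpace ℝ F] {a : α → ℝ} (ha : MemLp a ⊤ μ) {c : ℝ}
    (hc : ∀ᵐ x ∂μ, c ≤ a x) (p : Lp F 2 μ) : c * ‖p‖ ^ 2 ≤ weightedForm ha.toLp p p := by
  rw [weightedForm_toLp, ← integral_norm_sq, ← integral_const_mul]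
  refine integral_mono_ae ((integrable_norm_sq p).const_mul c)
    (integrable_weighted_inner ha p p) ?_
  filter_upwards [hc] with x hx
  rw [real_inner_self_eq_norm_sq]
  gcongr

/-- Existence and uniqueness for a coercive bilinear form and a bounded functional. -/
theorem existsUnique_of_isCoercive {V : Type*} [NormedAddCommGroup V] [InnerProductSpace ℝ V]
    [CompleteSpace V] {B : V →L[ℝ] V →L[ℝ] ℝ} (hB : IsCoercive B) (ℓ : V →L[ℝ] ℝ) :
    ∃! u, ∀ v, B u v = ℓ v := by
  let e := hB.continuousLinearEquivOfBilin
  let r := (InnerProductSpace.toDual ℝ V).symm ℓ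
  have hr : ∀ v, ⟪r, v⟫ = ℓ v := fun v => InnerProductSpace.toDual_symm_apply
  refine ⟨e.symm r, fun v => ?_, fun u hu => ?_⟩
  · rw [← hB.continuousLinearEquivOfBilin_apply, ← hr]
    exact congrArg (⟪·, v⟫) (e.apply_symm_apply r)
  · rw [ContinuousLinearEquiv.eq_symm_apply]
    exact (hB.unique_continuousLinearEquivOfBilin fun w => by rw [hr, hu]).symm

/-! ### The Robin form and the weak solution -/

/-- The bilinear form of the Robin problem on the trace graph. The coefficient enters twice: `a` is
its value in the domain and `s` its value on the boundary. -/
def robinForm (Ω : Set (E M)) (γ : ℝ) (a : Lp ℝ ⊤ (volume.restrict Ω)) (s : Lp ℝ ⊤ (surface Ω))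
    (b : Lp ℝ ⊤ (volume.restrict Ω)) : traceGraph Ω →L[ℝ] traceGraph Ω →L[ℝ] ℝ :=
  (weightedForm a).bilinearComp (gradL Ω) (gradL Ω)
    + γ • (weightedForm s).bilinearComp (trL Ω) (trL Ω)
    - (weightedForm b).bilinearComp (valL Ω) (valL Ω)

theorem robinForm_apply {Ω : Set (E M)} {γ : ℝ} (a : Lp ℝ ⊤ (volume.restrict Ω))
    (s : Lp ℝ ⊤ (surface Ω)) (b : Lp ℝ ⊤ (volume.restrict Ω)) (v w : traceGraph Ω) :
    robinForm Ω γ a s b v w = weightedForm a (gradL Ω v) (gradL Ω w)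
      + γ * weightedForm s (trL Ω v) (trL Ω w) - weightedForm b (valL Ω v) (valL Ω w) := rfl

/-- The functional `v ↦ ∫ f v` on the trace graph. -/
def loadL {Ω : Set (E M)} (f : Lp ℝ 2 (volume.restrict Ω)) : traceGraph Ω →L[ℝ] ℝ :=
  (innerSL ℝ f).comp (valL Ω)

theorem loadL_toLp {Ω : Set (E M)} {f : E M → ℝ} (hf : MemLp f 2 (volume.restrict Ω))
    (v : traceGraph Ω) : loadL hf.toLp v = ∫ x in Ω, f x * valL Ω v x := by
  change ⟪hf.toLp, valL Ω v⟫ = _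
  rw [L2.inner_def]
  apply integral_congr_ae
  filter_upwards [hf.coeFn_toLp] with x hx
  rw [hx]
  simp [mul_comm]

theorem robinForm_toLp {Ω : Set (E M)} {γ : ℝ} {a b : E M → ℝ}
    (ha : MemLp a ⊤ (volume.restrict Ω)) (hs : MemLp a ⊤ (surface Ω))
    (hb : MemLp b ⊤ (volume.restrict Ω)) (v w : traceGraph Ω) :
    robinForm Ω γ ha.toLp hs.toLp hb.toLp v w =
      (∫ x in Ω, a x * ⟪gradL Ω v x, gradL Ω w x⟫)
        + (∫ x, a x * γ * trL Ω v x * trL Ω w x ∂(surface Ω))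
        - ∫ x in Ω, b x * valL Ω v x * valL Ω w x := by
  rw [robinForm_apply, weightedForm_toLp, weightedForm_toLp, weightedForm_toLp,
    ← integral_const_mul]
  congr 2
  · congr 1
    ext x
    simp
    ring
  · ext x
    simp
    ring

theorem robinForm_comm {Ω : Set (E M)} {γ : ℝ} {a b : E M → ℝ}
    (ha : MemLp a ⊤ (volume.restrict Ω)) (hs : MemLp a ⊤ (surface Ω))
    (hb : MemLp b ⊤ (volume.restrict Ω)) (v w : traceGraph Ω) :
    robinForm Ω γ ha.toLp hs.toLp hb.toLp v w = robinForm Ω γ ha.toLp hs.toLp hb.toLp w v := by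
  simp only [robinForm_apply, weightedForm_toLp, real_inner_comm]

theorem isWeakSolution_iff {Ω : Set (E M)} {γ : ℝ} {a b f : E M → ℝ}
    (ha : MemLp a ⊤ (volume.restrict Ω)) (hs : MemLp a ⊤ (surface Ω))
    (hb : MemLp b ⊤ (volume.restrict Ω)) (hf : MemLp f 2 (volume.restrict Ω))
    (u : traceGraph Ω) : IsWeakSolution Ω γ b f a (traceGraphEquiv Ω u) ↔
      ∀ v, robinForm Ω γ ha.toLp hs.toLp hb.toLp u v = loadL hf.toLp v := by
  rw [IsWeakSolution, ← (traceGraphEquiv Ω).forall_congr_right]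
  simp only [robinForm_toLp, loadL_toLp, traceGraphEquiv_val, traceGraphEquiv_grad,
    traceGraphEquiv_tr]

/-- The arithmetic of the coercivity estimate. Here `X`, `Y`, `W` stand for the squared norms of the
gradient, of the boundary values and of the function, and `N` for the norm in the trace graph. -/
theorem coercivity_estimate {lo γ CF bbar X Y W N g t w : ℝ} (hlo : 0 < lo) (hγ : 0 < γ)
    (hCF : 0 < CF) (hbbar : 0 < bbar) (hbbar' : bbar < lo * min 1 γ / CF) (hX : 0 ≤ X)
    (hY : 0 ≤ Y) (hF : W + X ≤ CF * (X + Y)) (hN : N ^ 2 = W + X + Y) (hg : lo * X ≤ g)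
    (ht : lo * Y ≤ t) (hw : w ≤ bbar * W) :
    (lo * min 1 γ - bbar * CF) / (CF + 1) * N * N ≤ g + γ * t - w := by
  rw [lt_div_iff₀ hCF] at hbbar'
  have hval : W ≤ CF * (X + Y) := by linarith
  have hnorm : N ^ 2 ≤ (CF + 1) * (X + Y) := by linarith
  rw [mul_assoc, ← sq, div_mul_eq_mul_div, div_le_iff₀ (by linarith)]
  have k1 : lo * min 1 γ * X ≤ g := by
    refine le_trans ?_ hg
    have := mul_le_mul_of_nonneg_left (min_le_left 1 γ) hlo.le
    rw [mul_one] at this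
    gcongr
  have k2 : lo * min 1 γ * Y ≤ γ * t := by
    refine le_trans ?_ (mul_le_mul_of_nonneg_left ht hγ.le)
    rw [← mul_assoc, mul_comm γ lo]
    have := mul_le_mul_of_nonneg_left (min_le_right 1 γ) hlo.le
    gcongr
  have k3 : w ≤ bbar * (CF * (X + Y)) :=
    hw.trans (mul_le_mul_of_nonneg_left hval hbbar.le)
  calc (lo * min 1 γ - bbar * CF) * N ^ 2
      ≤ (lo * min 1 γ - bbar * CF) * ((CF + 1) * (X + Y)) :=
        mul_le_mul_of_nonneg_left hnorm (by linarith)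
    _ = (lo * min 1 γ * X + lo * min 1 γ * Y - bbar * (CF * (X + Y))) * (CF + 1) := by ring
    _ ≤ _ := mul_le_mul_of_nonneg_right (by linarith) (by linarith)

/-- The Friedrichs inequality and the smallness of `b` make the Robin form coercive in the norm of
the trace graph, which also contains the boundary values. -/
theorem isCoercive_robinForm {Ω : Set (E M)} {γ lo CF bbar : ℝ} (hlo : 0 < lo) (hγ : 0 < γ)
    (hCF : 0 < CF) (hbbar : 0 < bbar) (hbbar' : bbar < lo * min 1 γ / CF)
    (hF : ∀ v : H1Tr Ω, ‖v.toH1‖ ^ 2 ≤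
      CF * ((∫ x in Ω, ‖v.grad x‖ ^ 2) + ∫ x, v.tr x ^ 2 ∂(surface Ω)))
    {a b : E M → ℝ} (ha : MemLp a ⊤ (volume.restrict Ω)) (hs : MemLp a ⊤ (surface Ω))
    (hb : MemLp b ⊤ (volume.restrict Ω)) (hla : ∀ᵐ x ∂(volume.restrict Ω), lo ≤ a x)
    (hls : ∀ᵐ x ∂(surface Ω), lo ≤ a x) (hb' : ∀ᵐ x ∂(volume.restrict Ω), b x ≤ bbar) :
    IsCoercive (robinForm Ω γ ha.toLp hs.toLp hb.toLp) := by
  refine ⟨(lo * min 1 γ - bbar * CF) / (CF + 1), div_pos ?_ (by linarith), fun v => ?_⟩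
  · rw [lt_div_iff₀ hCF] at hbbar'
    linarith
  have h4 := hF (traceGraphEquiv Ω v)
  have h5 : ∫ x, trL Ω v x ^ 2 ∂(surface Ω) = ‖trL Ω v‖ ^ 2 := by
    rw [← integral_norm_sq]
    simp only [Real.norm_eq_abs, sq_abs]
  rw [traceGraphEquiv_grad, traceGraphEquiv_tr, integral_norm_sq, h5, norm_sq_toH1] at h4
  have h6 := norm_sq_traceGraph v
  rw [norm_sq_toH1] at h6
  rw [robinForm_apply]
  exact coercivity_estimate hlo hγ hCF hbbar hbbar' (sq_nonneg _) (sq_nonneg _) h4 h6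
    (le_weightedForm_self ha hla (gradL Ω v)) (le_weightedForm_self hs hls (trL Ω v))
    (weightedForm_self_le hb hb' (valL Ω v))

theorem robinForm_self_nonneg {Ω : Set (E M)} {γ : ℝ} {a s b}
    (hB : IsCoercive (robinForm Ω γ a s b)) (v : traceGraph Ω) :
    0 ≤ robinForm Ω γ a s b v v := by
  obtain ⟨C, hC, h⟩ := hB
  exact le_trans (by positivity) (h v)

/-! ### The energy as a maximum of affine functionals -/

/-- A lower bound for the energy `G_z(a)`, affine in the coefficient `a`. With the bilinear form `A`
and the load `L` of the problem it is `L(v) - A(v, v) / 2 - L(z) + A(z, z) / 2`. -/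
def affineMinorant (Ω : Set (E M)) (γ : ℝ) (b f : E M → ℝ) (z v : traceGraph Ω)
    (a : E M → ℝ) : ℝ :=
  ((∫ x in Ω, f x * valL Ω v x) - (∫ x in Ω, f x * valL Ω z x)
      + 1 / 2 * (∫ x in Ω, b x * ⟪valL Ω v x, valL Ω v x⟫)
      - 1 / 2 * ∫ x in Ω, b x * ⟪valL Ω z x, valL Ω z x⟫)
    + (∫ x in Ω, a x * (1 / 2 * (‖gradL Ω z x‖ ^ 2 - ‖gradL Ω v x‖ ^ 2)))
    + ∫ x, a x * (γ / 2 * (‖trL Ω z x‖ ^ 2 - ‖trL Ω v x‖ ^ 2)) ∂(surface Ω)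

theorem affineMinorant_eq {Ω : Set (E M)} {γ : ℝ} {a b f : E M → ℝ}
    (ha : MemLp a ⊤ (volume.restrict Ω)) (hs : MemLp a ⊤ (surface Ω))
    (hb : MemLp b ⊤ (volume.restrict Ω)) (hf : MemLp f 2 (volume.restrict Ω))
    (z v : traceGraph Ω) : affineMinorant Ω γ b f z v a =
      loadL hf.toLp v - 1 / 2 * robinForm Ω γ ha.toLp hs.toLp hb.toLp v v
        - loadL hf.toLp z + 1 / 2 * robinForm Ω γ ha.toLp hs.toLp hb.toLp z z := by
  have e1 : ∫ x in Ω, a x * (1 / 2 * (‖gradL Ω z x‖ ^ 2 - ‖gradL Ω v x‖ ^ 2)) =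
      1 / 2 * (∫ x in Ω, a x * ⟪gradL Ω z x, gradL Ω z x⟫)
        - 1 / 2 * ∫ x in Ω, a x * ⟪gradL Ω v x, gradL Ω v x⟫ := by
    rw [← mul_sub, ← integral_sub (integrable_weighted_inner ha _ _)
      (integrable_weighted_inner ha _ _), ← integral_const_mul]
    congr 1
    ext x
    simp only [real_inner_self_eq_norm_sq]
    ring
  have e2 : ∫ x, a x * (γ / 2 * (‖trL Ω z x‖ ^ 2 - ‖trL Ω v x‖ ^ 2)) ∂(surface Ω) =
      γ / 2 * (∫ x, a x * ⟪trL Ω z x, trL Ω z x⟫ ∂(surface Ω))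
        - γ / 2 * ∫ x, a x * ⟪trL Ω v x, trL Ω v x⟫ ∂(surface Ω) := by
    rw [← mul_sub, ← integral_sub (integrable_weighted_inner hs _ _)
      (integrable_weighted_inner hs _ _), ← integral_const_mul]
    congr 1
    ext x
    simp only [real_inner_self_eq_norm_sq]
    ring
  rw [affineMinorant, e1, e2, robinForm_apply, robinForm_apply, loadL_toLp, loadL_toLp]
  simp only [weightedForm_toLp]
  ring

theorem G_eq_robinForm {Ω : Set (E M)} {γ : ℝ} {a b f : E M → ℝ}
    (ha : MemLp a ⊤ (volume.restrict Ω)) (hs : MemLp a ⊤ (surface Ω))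
    (hb : MemLp b ⊤ (volume.restrict Ω)) {z u : traceGraph Ω}
    (hu : U Ω γ b f a = traceGraphEquiv Ω u) :
    G Ω γ b f (traceGraphEquiv Ω z) a =
      1 / 2 * robinForm Ω γ ha.toLp hs.toLp hb.toLp (u - z) (u - z) := by
  have e1 : ∫ x in Ω, a x * ‖gradL Ω u x - gradL Ω z x‖ ^ 2 =
      ∫ x in Ω, a x * ⟪gradL Ω (u - z) x, gradL Ω (u - z) x⟫ := by
    apply integral_congr_ae
    filter_upwards [Lp.coeFn_sub (gradL Ω u) (gradL Ω z)] with x hx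
    rw [map_sub, hx, real_inner_self_eq_norm_sq, Pi.sub_apply]
  have e2 : ∫ x, a x * γ * (trL Ω u x - trL Ω z x) ^ 2 ∂(surface Ω) =
      ∫ x, a x * γ * trL Ω (u - z) x * trL Ω (u - z) x ∂(surface Ω) := by
    apply integral_congr_ae
    filter_upwards [Lp.coeFn_sub (trL Ω u) (trL Ω z)] with x hx
    rw [map_sub, hx, Pi.sub_apply]
    ring
  have e3 : ∫ x in Ω, b x * (valL Ω u x - valL Ω z x) ^ 2 =
      ∫ x in Ω, b x * valL Ω (u - z) x * valL Ω (u - z) x := by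
    apply integral_congr_ae
    filter_upwards [Lp.coeFn_sub (valL Ω u) (valL Ω z)] with x hx
    rw [map_sub, hx, Pi.sub_apply]
    ring
  rw [G, hu, robinForm_toLp]
  simp only [traceGraphEquiv_grad, traceGraphEquiv_tr, traceGraphEquiv_val, e1, e2, e3]
  ring

theorem U_spec {Ω : Set (E M)} {γ : ℝ} {a b f : E M → ℝ}
    (h : ∃! u : H1Tr Ω, IsWeakSolution Ω γ b f a u) :
    IsWeakSolution Ω γ b f a (U Ω γ b f a) :=
  Classical.epsilon_spec h.exists

theorem existsUnique_isWeakSolution {Ω : Set (E M)} {γ : ℝ} {a b f : E M → ℝ}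
    (ha : MemLp a ⊤ (volume.restrict Ω)) (hs : MemLp a ⊤ (surface Ω))
    (hb : MemLp b ⊤ (volume.restrict Ω)) (hf : MemLp f 2 (volume.restrict Ω))
    (hB : IsCoercive (robinForm Ω γ ha.toLp hs.toLp hb.toLp)) :
    ∃! u : H1Tr Ω, IsWeakSolution Ω γ b f a u := by
  refine (traceGraphEquiv Ω).existsUnique_congr_right.1 ?_
  simp only [isWeakSolution_iff ha hs hb hf]
  exact existsUnique_of_isCoercive hB _

/-- The dual description of the energy: `G_z(a)` is the largest of its affine minorants, and the
weak solution attains it. The difference to the minorant at `v` is `A(u - v, u - v) / 2 ≥ 0`, where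
`u` is the weak solution. -/
theorem G_isGreatest {Ω : Set (E M)} {γ : ℝ} {a b f : E M → ℝ}
    (ha : MemLp a ⊤ (volume.restrict Ω)) (hs : MemLp a ⊤ (surface Ω))
    (hb : MemLp b ⊤ (volume.restrict Ω)) (hf : MemLp f 2 (volume.restrict Ω))
    (hB : IsCoercive (robinForm Ω γ ha.toLp hs.toLp hb.toLp)) (z : traceGraph Ω) :
    IsGreatest (range fun v => affineMinorant Ω γ b f z v a)
      (G Ω γ b f (traceGraphEquiv Ω z) a) := by
  obtain ⟨u, hu⟩ := (traceGraphEquiv Ω).surjective (U Ω γ b f a)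
  have hsol := U_spec (existsUnique_isWeakSolution ha hs hb hf hB)
  rw [← hu, isWeakSolution_iff ha hs hb hf] at hsol
  have key : ∀ v, G Ω γ b f (traceGraphEquiv Ω z) a = affineMinorant Ω γ b f z v a
      + 1 / 2 * robinForm Ω γ ha.toLp hs.toLp hb.toLp (u - v) (u - v) := by
    intro v
    rw [G_eq_robinForm ha hs hb hu.symm, affineMinorant_eq ha hs hb hf]
    simp only [map_sub, sub_apply]
    rw [robinForm_comm ha hs hb z u, robinForm_comm ha hs hb v u, hsol u, hsol z, hsol v]
    ring
  refine ⟨⟨u, ?_⟩, ?_⟩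
  · have := key u
    simp only [sub_self, map_zero, mul_zero, add_zero] at this
    exact this.symm
  · rintro _ ⟨v, rfl⟩
    have h := robinForm_self_nonneg hB (u - v)
    have := key v
    dsimp only
    linarith

/-! ### Minimizing a maximum of convex functionals over bounded coefficients -/

/-- The functions with values in `[lo, hi]` almost everywhere. -/
def boundedCoefficients {α : Type*} [MeasurableSpace α] (μ : Measure α) (lo hi : ℝ) :
    Set (α → ℝ) :=
  {a | AEMeasurable a μ ∧ ∀ᵐ x ∂μ, lo ≤ a x ∧ a x ≤ hi}

section boundedCoefficients

variable {α : Type*} [MeasurableSpace α] {μ : Measure α} {lo hi : ℝ}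

theorem memLp_of_mem_boundedCoefficients [IsFiniteMeasure μ] {a : α → ℝ}
    (ha : a ∈ boundedCoefficients μ lo hi) (p : ℝ≥0∞) : MemLp a p μ :=
  memLp_of_bounded (a := lo) (b := hi) ha.2 ha.1.aestronglyMeasurable p

theorem boundedCoefficients_mono {ν : Measure α} (h : ν ≪ μ) :
    boundedCoefficients μ lo hi ⊆ boundedCoefficients ν lo hi :=
  fun _ ha => ⟨ha.1.mono_ac h, h.ae_le ha.2⟩

theorem convex_boundedCoefficients : Convex ℝ (boundedCoefficients μ lo hi) := by
  intro a ha a' ha' t s ht hs hts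
  refine ⟨(ha.1.const_smul t).add (ha'.1.const_smul s), ?_⟩
  filter_upwards [ha.2, ha'.2] with x h h'
  exact convex_Icc lo hi h h' ht hs hts

theorem boundedCoefficients_congr {a a' : α → ℝ} (ha : a ∈ boundedCoefficients μ lo hi)
    (h : a =ᵐ[μ] a') : a' ∈ boundedCoefficients μ lo hi := by
  refine ⟨ha.1.congr h, ?_⟩
  filter_upwards [ha.2, h] with x hx hxe
  rwa [← hxe]

/-- A pointwise maximum `J` of functionals that are convex, and continuous along almost everywhere
convergent sequences, attains its minimum over the coefficients with values in `[lo, hi]`: in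
`L²(μ)` the sets `{J ≤ inf J + 1 / (n + 1)}` are closed, convex, bounded and decreasing. -/
theorem exists_isMinOn_of_isGreatest [IsFiniteMeasure μ] (hlohi : lo ≤ hi) {ι : Type*}
    {P : ι → (α → ℝ) → ℝ} {J : (α → ℝ) → ℝ} {c₀ : ℝ}
    (hJ : ∀ a ∈ boundedCoefficients μ lo hi, IsGreatest (range fun i => P i a) (J a))
    (hbdd : ∀ a ∈ boundedCoefficients μ lo hi, c₀ ≤ J a)
    (hcongr : ∀ i a a', a =ᵐ[μ] a' → P i a = P i a')
    (hconv : ∀ i, ConvexOn ℝ (boundedCoefficients μ lo hi) (P i))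
    (hcont : ∀ i (a : ℕ → α → ℝ) (a' : α → ℝ), (∀ n, a n ∈ boundedCoefficients μ lo hi) →
      (∀ᵐ x ∂μ, Tendsto (fun n => a n x) atTop (𝓝 (a' x))) →
      Tendsto (fun n => P i (a n)) atTop (𝓝 (P i a'))) :
    ∃ a ∈ boundedCoefficients μ lo hi, IsMinOn J (boundedCoefficients μ lo hi) a := by
  let m := sInf (J '' boundedCoefficients μ lo hi)
  have hne : (J '' boundedCoefficients μ lo hi).Nonempty :=
    ⟨_, fun _ => lo, ⟨aemeasurable_const, .of_forall fun _ => ⟨le_rfl, hlohi⟩⟩, rfl⟩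
  have hbelow : BddBelow (J '' boundedCoefficients μ lo hi) := by
    refine ⟨c₀, ?_⟩
    rintro _ ⟨a, ha, rfl⟩
    exact hbdd a ha
  let C : ℕ → Set (Lp ℝ 2 μ) := fun n =>
    {A | ⇑A ∈ boundedCoefficients μ lo hi ∧ ∀ i, P i A ≤ m + 1 / ((n : ℝ) + 1)}
  have hC : (⋂ n, C n).Nonempty := by
    refine nonempty_iInter_of_antitone_convex
      (R := measureUnivNNReal μ ^ (2 : ℝ≥0∞).toReal⁻¹ * max |lo| |hi|) ?_ ?_ ?_ ?_ ?_
    · intro k n hkn A hA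
      refine ⟨hA.1, fun i => (hA.2 i).trans ?_⟩
      have : (k : ℝ) ≤ n := by exact_mod_cast hkn
      gcongr
    · intro n
      obtain ⟨_, ⟨a, ha, rfl⟩, hlt⟩ :=
        exists_lt_of_csInf_lt hne (show m < m + 1 / ((n : ℝ) + 1) by
          have : 0 < 1 / ((n : ℝ) + 1) := by positivity
          linarith)
      have hmem := memLp_of_mem_boundedCoefficients ha 2
      refine ⟨hmem.toLp, boundedCoefficients_congr ha hmem.coeFn_toLp.symm, fun i => ?_⟩
      rw [hcongr i _ _ hmem.coeFn_toLp]
      exact ((hJ a ha).2 ⟨i, rfl⟩).trans hlt.le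
    · intro n
      refine IsSeqClosed.isClosed fun A A' hA hlim => ?_
      obtain ⟨φ, -, hφ⟩ := (tendstoInMeasure_of_tendsto_Lp hlim).exists_seq_tendsto_ae
      refine ⟨⟨(Lp.aestronglyMeasurable A').aemeasurable, ?_⟩, fun i => ?_⟩
      · filter_upwards [hφ, ae_all_iff.2 fun k => (hA k).1.2] with x hx hb
        exact isClosed_Icc.mem_of_tendsto hx (.of_forall fun k => hb (φ k))
      · exact le_of_tendsto' (hcont i _ _ (fun k => (hA (φ k)).1) hφ) fun k => (hA (φ k)).2 i
    · intro n A hA A' hA' t s ht hs hts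
      have he : ⇑(t • A + s • A') =ᵐ[μ] t • ⇑A + s • ⇑A' := by
        filter_upwards [Lp.coeFn_add (t • A) (s • A'), Lp.coeFn_smul t A, Lp.coeFn_smul s A']
          with x h1 h2 h3
        rw [h1, Pi.add_apply, h2, h3, Pi.add_apply]
      refine ⟨boundedCoefficients_congr
        (convex_boundedCoefficients hA.1 hA'.1 ht hs hts) he.symm, fun i => ?_⟩
      rw [hcongr i _ _ he]
      refine ((hconv i).2 hA.1 hA'.1 ht hs hts).trans ?_
      exact convex_Iic (m + 1 / ((n : ℝ) + 1)) (hA.2 i) (hA'.2 i) ht hs hts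
    · intro A hA
      refine Lp.norm_le_of_ae_bound (by positivity) ?_
      filter_upwards [hA.1.2] with x hx
      exact abs_le_max_abs_abs hx.1 hx.2
  obtain ⟨A, hA⟩ := hC
  rw [mem_iInter] at hA
  refine ⟨A, (hA 0).1, fun a ha => ?_⟩
  obtain ⟨i, hi⟩ := (hJ A (hA 0).1).1
  have hle : J A ≤ m := by
    rw [← hi]
    refine ge_of_tendsto' (x := atTop) (f := fun n : ℕ => m + 1 / ((n : ℝ) + 1)) ?_
      fun n => (hA n).2 i
    simpa using tendsto_one_div_add_atTop_nhds_zero_nat.const_add m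
  exact hle.trans (csInf_le hbelow ⟨a, ha, rfl⟩)

theorem norm_le_of_mem_Icc {lo hi y : ℝ} (h : lo ≤ y ∧ y ≤ hi) : ‖y‖ ≤ max |lo| |hi| :=
  abs_le_max_abs_abs h.1 h.2

theorem tendsto_integral_mul_of_bounded {a : ℕ → α → ℝ} {a' h : α → ℝ}
    (ha : ∀ n, a n ∈ boundedCoefficients μ lo hi) (hh : Integrable h μ)
    (hlim : ∀ᵐ x ∂μ, Tendsto (fun n => a n x) atTop (𝓝 (a' x))) :
    Tendsto (fun n => ∫ x, a n x * h x ∂μ) atTop (𝓝 (∫ x, a' x * h x ∂μ)) := by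
  refine tendsto_integral_of_dominated_convergence (fun x => max |lo| |hi| * ‖h x‖)
    (fun n => (ha n).1.aestronglyMeasurable.mul hh.1) (hh.norm.const_mul _) (fun n => ?_) ?_
  · filter_upwards [(ha n).2] with x hx
    rw [norm_mul]
    exact mul_le_mul_of_nonneg_right (norm_le_of_mem_Icc hx) (norm_nonneg _)
  · filter_upwards [hlim] with x hx using hx.mul_const _

theorem tendsto_integral_sub_sq_of_bounded [IsFiniteMeasure μ] {a : ℕ → α → ℝ} {a' c : α → ℝ}
    (ha : ∀ n, a n ∈ boundedCoefficients μ lo hi) (hc : MemLp c 2 μ)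
    (hlim : ∀ᵐ x ∂μ, Tendsto (fun n => a n x) atTop (𝓝 (a' x))) :
    Tendsto (fun n => ∫ x, (a n x - c x) ^ 2 ∂μ) atTop (𝓝 (∫ x, (a' x - c x) ^ 2 ∂μ)) := by
  have hbound : MemLp (fun x => max |lo| |hi| + ‖c x‖) 2 μ := by
    exact MemLp.add (memLp_const (max |lo| |hi|)) hc.norm
  refine tendsto_integral_of_dominated_convergence (fun x => (max |lo| |hi| + ‖c x‖) ^ 2)
    (fun n => ((ha n).1.aestronglyMeasurable.sub hc.1).pow 2)
    hbound.integrable_sq (fun n => ?_) ?_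
  · filter_upwards [(ha n).2] with x hx
    rw [norm_pow]
    have := (norm_sub_le (a n x) (c x)).trans (add_le_add_left (norm_le_of_mem_Icc hx) _)
    gcongr
  · filter_upwards [hlim] with x hx using (hx.sub_const _).pow 2

/-- The quadratic identity behind the strong convexity of the penalty. -/
theorem integral_convexCombination_sub_sq {a a' c : α → ℝ} (ha : MemLp a 2 μ) (ha' : MemLp a' 2 μ)
    (hc : MemLp c 2 μ) {t s : ℝ} (hts : t + s = 1) :
    ∫ x, ((t • a + s • a') x - c x) ^ 2 ∂μ = t * (∫ x, (a x - c x) ^ 2 ∂μ)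
      + s * (∫ x, (a' x - c x) ^ 2 ∂μ) - t * s * ∫ x, (a x - a' x) ^ 2 ∂μ := by
  have i1 : Integrable (fun x => t * (a x - c x) ^ 2) μ := (ha.sub hc).integrable_sq.const_mul t
  have i2 : Integrable (fun x => s * (a' x - c x) ^ 2) μ := (ha'.sub hc).integrable_sq.const_mul s
  have i12 : Integrable (fun x => t * (a x - c x) ^ 2 + s * (a' x - c x) ^ 2) μ := i1.add i2
  have i3 : Integrable (fun x => t * s * (a x - a' x) ^ 2) μ :=
    (ha.sub ha').integrable_sq.const_mul (t * s)
  rw [← integral_const_mul, ← integral_const_mul, ← integral_const_mul, ← integral_add i1 i2,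
    ← integral_sub i12 i3]
  congr 1
  ext x
  obtain rfl : s = 1 - t := by linarith
  simp only [Pi.add_apply, Pi.smul_apply, smul_eq_mul]
  ring

theorem integral_convexCombination_mul {a a' h : α → ℝ} (ha : MemLp a ⊤ μ) (ha' : MemLp a' ⊤ μ)
    (hh : Integrable h μ) (t s : ℝ) : ∫ x, (t • a + s • a') x * h x ∂μ =
      t * (∫ x, a x * h x ∂μ) + s * ∫ x, a' x * h x ∂μ := by
  have i1 : Integrable (fun x => a x * h x) μ := hh.mul_of_top_right ha
  have i2 : Integrable (fun x => a' x * h x) μ := hh.mul_of_top_right ha'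
  rw [← integral_const_mul, ← integral_const_mul,
    ← integral_add (i1.const_mul t) (i2.const_mul s)]
  congr 1
  ext x
  simp only [Pi.add_apply, Pi.smul_apply, smul_eq_mul]
  ring

end boundedCoefficients

/-! ### Minorants of the Tikhonov functional -/

/-- Admissibility is a condition on a single measure, the sum of Lebesgue measure on `Ω` and surface
measure on `∂Ω₁`. -/
theorem admissible_eq (Ω Ω₁ : Set (E M)) (lo hi : ℝ) : admissible Ω Ω₁ lo hi =
    boundedCoefficients (volume.restrict Ω + surface Ω₁) lo hi := by
  ext a
  simp only [admissible, boundedCoefficients, mem_ofPred_eq, aemeasurable_add_measure_iff,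
    ae_add_measure_iff]
  tauto

theorem integrable_affineMinorant_interior {Ω : Set (E M)} (z v : traceGraph Ω) :
    Integrable (fun x => 1 / 2 * (‖gradL Ω z x‖ ^ 2 - ‖gradL Ω v x‖ ^ 2)) (volume.restrict Ω) :=
  ((integrable_norm_sq _).sub (integrable_norm_sq _)).const_mul _

theorem integrable_affineMinorant_boundary {Ω : Set (E M)} (γ : ℝ) (z v : traceGraph Ω) :
    Integrable (fun x => γ / 2 * (‖trL Ω z x‖ ^ 2 - ‖trL Ω v x‖ ^ 2)) (surface Ω) :=
  ((integrable_norm_sq _).sub (integrable_norm_sq _)).const_mul _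

/-- The affine minorant of the energy plus the penalty: a strongly convex minorant of the Tikhonov
functional. -/
def tikhonovMinorant (Ω Ω₁ : Set (E M)) (γ : ℝ) (b f : E M → ℝ) (z : traceGraph Ω₁) (ρ : ℝ)
    (aStar : E M → ℝ) (v : traceGraph Ω₁) (a : E M → ℝ) : ℝ :=
  affineMinorant Ω₁ γ b f z v a + ρ * ∫ x in Ω, (a x - aStar x) ^ 2

theorem affineMinorant_self {Ω : Set (E M)} (γ : ℝ) (b f a : E M → ℝ) (z : traceGraph Ω) :
    affineMinorant Ω γ b f z z a = 0 := by
  simp only [affineMinorant, sub_self, mul_zero, integral_zero]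
  ring

theorem tikhonovMinorant_congr {Ω Ω₁ : Set (E M)} (hsub : Ω₁ ⊆ Ω) (γ : ℝ) (b f : E M → ℝ)
    (z : traceGraph Ω₁) (ρ : ℝ) (aStar : E M → ℝ) (v : traceGraph Ω₁) {a a' : E M → ℝ}
    (h : a =ᵐ[volume.restrict Ω + surface Ω₁] a') :
    tikhonovMinorant Ω Ω₁ γ b f z ρ aStar v a = tikhonovMinorant Ω Ω₁ γ b f z ρ aStar v a' := by
  obtain ⟨h1, h2⟩ := ae_add_measure_iff.1 h
  have h3 := ae_restrict_of_ae_restrict_of_subset hsub h1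
  rw [tikhonovMinorant, tikhonovMinorant, affineMinorant, affineMinorant]
  congr 1
  · congr 1
    · congr 1
      apply integral_congr_ae
      filter_upwards [h3] with x hx
      rw [hx]
    · apply integral_congr_ae
      filter_upwards [h2] with x hx
      rw [hx]
  · congr 1
    apply integral_congr_ae
    filter_upwards [h1] with x hx
    rw [hx]

theorem restrict_absolutelyContinuous_add {Ω Ω₁ : Set (E M)} (hsub : Ω₁ ⊆ Ω) :
    volume.restrict Ω₁ ≪ volume.restrict Ω + surface Ω₁ :=
  (Measure.restrict_mono_set volume hsub).absolutelyContinuous.trans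
    (Measure.le_add_right le_rfl).absolutelyContinuous

theorem restrict_absolutelyContinuous_add' (Ω Ω₁ : Set (E M)) :
    volume.restrict Ω ≪ volume.restrict Ω + surface Ω₁ :=
  (Measure.le_add_right le_rfl).absolutelyContinuous

theorem surface_absolutelyContinuous_add (Ω Ω₁ : Set (E M)) :
    surface Ω₁ ≪ volume.restrict Ω + surface Ω₁ :=
  (Measure.le_add_left le_rfl).absolutelyContinuous

theorem tikhonovMinorant_tendsto {Ω Ω₁ : Set (E M)}
    [IsFiniteMeasure ((volume : Measure (E M)).restrict Ω)] (hsub : Ω₁ ⊆ Ω)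
    {lo hi : ℝ} (γ : ℝ) (b f : E M → ℝ) (z : traceGraph Ω₁) (ρ : ℝ) {aStar : E M → ℝ}
    (hc : MemLp aStar 2 (volume.restrict Ω)) (v : traceGraph Ω₁) {a : ℕ → E M → ℝ} {a' : E M → ℝ}
    (ha : ∀ n, a n ∈ boundedCoefficients (volume.restrict Ω + surface Ω₁) lo hi)
    (hlim : ∀ᵐ x ∂(volume.restrict Ω + surface Ω₁), Tendsto (fun n => a n x) atTop (𝓝 (a' x))) :
    Tendsto (fun n => tikhonovMinorant Ω Ω₁ γ b f z ρ aStar v (a n)) atTop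
      (𝓝 (tikhonovMinorant Ω Ω₁ γ b f z ρ aStar v a')) := by
  have c1 := restrict_absolutelyContinuous_add hsub
  have c2 := surface_absolutelyContinuous_add Ω Ω₁
  have c3 := restrict_absolutelyContinuous_add' Ω Ω₁
  refine ((tendsto_const_nhds.add ?_).add ?_).add (Tendsto.const_mul ρ ?_)
  · exact tendsto_integral_mul_of_bounded (fun n => boundedCoefficients_mono c1 (ha n))
      (integrable_affineMinorant_interior z v) (c1.ae_le hlim)
  · exact tendsto_integral_mul_of_bounded (fun n => boundedCoefficients_mono c2 (ha n))
      (integrable_affineMinorant_boundary γ z v) (c2.ae_le hlim)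
  · exact tendsto_integral_sub_sq_of_bounded (fun n => boundedCoefficients_mono c3 (ha n))
      hc (c3.ae_le hlim)

section

variable {Ω Ω₁ : Set (E M)} [IsFiniteMeasure ((volume : Measure (E M)).restrict Ω)]
  [IsFiniteMeasure ((volume : Measure (E M)).restrict Ω₁)] [IsFiniteMeasure (surface Ω₁)]

theorem tikhonovMinorant_convexCombination (hsub : Ω₁ ⊆ Ω) {lo hi : ℝ} (γ : ℝ) (b f : E M → ℝ)
    (z : traceGraph Ω₁) (ρ : ℝ) {aStar : E M → ℝ} (hc : MemLp aStar 2 (volume.restrict Ω))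
    (v : traceGraph Ω₁) {a a' : E M → ℝ}
    (ha : a ∈ boundedCoefficients (volume.restrict Ω + surface Ω₁) lo hi)
    (ha' : a' ∈ boundedCoefficients (volume.restrict Ω + surface Ω₁) lo hi)
    {t s : ℝ} (hts : t + s = 1) :
    tikhonovMinorant Ω Ω₁ γ b f z ρ aStar v (t • a + s • a') =
      t * tikhonovMinorant Ω Ω₁ γ b f z ρ aStar v a
        + s * tikhonovMinorant Ω Ω₁ γ b f z ρ aStar v a'
        - ρ * (t * s) * ∫ x in Ω, (a x - a' x) ^ 2 := by
  have c1 := boundedCoefficients_mono (lo := lo) (hi := hi)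
    (restrict_absolutelyContinuous_add hsub)
  have c2 := boundedCoefficients_mono (lo := lo) (hi := hi)
    (surface_absolutelyContinuous_add Ω Ω₁)
  have c3 := boundedCoefficients_mono (lo := lo) (hi := hi)
    (restrict_absolutelyContinuous_add' Ω Ω₁)
  simp only [tikhonovMinorant, affineMinorant]
  rw [integral_convexCombination_sub_sq (memLp_of_mem_boundedCoefficients (c3 ha) 2)
      (memLp_of_mem_boundedCoefficients (c3 ha') 2) hc hts,
    integral_convexCombination_mul (memLp_of_mem_boundedCoefficients (c1 ha) ⊤)
      (memLp_of_mem_boundedCoefficients (c1 ha') ⊤) (integrable_affineMinorant_interior z v),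
    integral_convexCombination_mul (memLp_of_mem_boundedCoefficients (c2 ha) ⊤)
      (memLp_of_mem_boundedCoefficients (c2 ha') ⊤) (integrable_affineMinorant_boundary γ z v)]
  obtain rfl : s = 1 - t := by linarith
  ring

theorem convexOn_tikhonovMinorant (hsub : Ω₁ ⊆ Ω) {lo hi : ℝ} (γ : ℝ) (b f : E M → ℝ)
    (z : traceGraph Ω₁) {ρ : ℝ} (hρ : 0 < ρ) {aStar : E M → ℝ}
    (hc : MemLp aStar 2 (volume.restrict Ω)) (v : traceGraph Ω₁) :
    ConvexOn ℝ (boundedCoefficients (volume.restrict Ω + surface Ω₁) lo hi)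
      (tikhonovMinorant Ω Ω₁ γ b f z ρ aStar v) := by
  refine ⟨convex_boundedCoefficients, fun a ha a' ha' t s ht hs hts => ?_⟩
  rw [tikhonovMinorant_convexCombination hsub γ b f z ρ hc v ha ha' hts, smul_eq_mul, smul_eq_mul]
  have h : 0 ≤ ∫ x in Ω, (a x - a' x) ^ 2 := integral_nonneg fun x => sq_nonneg _
  have := mul_nonneg (mul_nonneg hρ.le (mul_nonneg ht hs)) h
  linarith

/-- Two minimizers agree almost everywhere: at their midpoint the minorant that touches the Tikhonov
functional there would otherwise lie strictly below the minimum. -/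
theorem ae_eq_of_isMinOn (hsub : Ω₁ ⊆ Ω) {lo hi : ℝ} {γ : ℝ} {b f : E M → ℝ}
    {z : traceGraph Ω₁} {ρ : ℝ} (hρ : 0 < ρ) {aStar : E M → ℝ}
    (hc : MemLp aStar 2 (volume.restrict Ω)) {J : (E M → ℝ) → ℝ}
    (hJ : ∀ a ∈ boundedCoefficients (volume.restrict Ω + surface Ω₁) lo hi,
      IsGreatest (range fun v => tikhonovMinorant Ω Ω₁ γ b f z ρ aStar v a) (J a))
    {a a' : E M → ℝ} (ha : a ∈ boundedCoefficients (volume.restrict Ω + surface Ω₁) lo hi)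
    (ha' : a' ∈ boundedCoefficients (volume.restrict Ω + surface Ω₁) lo hi)
    (hmin : IsMinOn J (boundedCoefficients (volume.restrict Ω + surface Ω₁) lo hi) a)
    (hmin' : IsMinOn J (boundedCoefficients (volume.restrict Ω + surface Ω₁) lo hi) a') :
    a' =ᵐ[volume.restrict Ω] a := by
  have hmid := convex_boundedCoefficients ha ha' (a := (1 / 2 : ℝ)) (b := 1 / 2) (by norm_num)
    (by norm_num) (by norm_num)
  obtain ⟨v, hv⟩ := (hJ _ hmid).1
  dsimp only at hv
  rw [tikhonovMinorant_convexCombination hsub γ b f z ρ hc v ha ha' (by norm_num)] at hv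
  have h1 := (hJ a ha).2 ⟨v, rfl⟩
  have h2 := (hJ a' ha').2 ⟨v, rfl⟩
  have h3 := isMinOn_iff.1 hmin _ hmid
  have h4 := isMinOn_iff.1 hmin' _ ha
  dsimp only at h1 h2
  have h5 : ρ * ∫ x in Ω, (a x - a' x) ^ 2 ≤ 0 := by linarith
  have h6 : ∫ x in Ω, (a x - a' x) ^ 2 = 0 := by
    refine le_antisymm ?_ (integral_nonneg fun x => sq_nonneg _)
    exact nonpos_of_mul_nonpos_right h5 hρ
  have c3 := boundedCoefficients_mono (lo := lo) (hi := hi)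
    (restrict_absolutelyContinuous_add' Ω Ω₁)
  have hint : Integrable (fun x => (a x - a' x) ^ 2) (volume.restrict Ω) :=
    ((memLp_of_mem_boundedCoefficients (c3 ha) 2).sub
      (memLp_of_mem_boundedCoefficients (c3 ha') 2)).integrable_sq
  rw [integral_eq_zero_iff_of_nonneg (fun x => sq_nonneg _) hint] at h6
  filter_upwards [h6] with x hx
  have := pow_eq_zero_iff (two_ne_zero) |>.1 hx
  linarith

end

end RobinInverse

end

theorem theorem2p1 {M : ℕ} (hM : 1 < M) (Ω Ω₁ : Set (RobinInverse.E M))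
    (hΩ : IsOpen Ω) (hΩb : Bornology.IsBounded Ω)
    (hΩ₁ : IsOpen Ω₁) (hΩ₁c : IsConnected Ω₁) (hsub : Ω₁ ⊆ Ω)
    (hLip : RobinInverse.HasLipschitzBoundary Ω₁)
    (γ : ℝ) (hγ : 0 < γ)
    (lo hi : ℝ) (hlo : 0 < lo) (hlohi : lo < hi)
    -- the constant of the Friedrichs inequality on `Ω₁`
    (CF : ℝ) (hCF : 0 < CF)
    (hFriedrichs : ∀ v : RobinInverse.H1Tr Ω₁, ‖v.toH1‖ ^ 2 ≤
      CF * ((∫ x in Ω₁, ‖v.grad x‖ ^ 2) + ∫ x, v.tr x ^ 2 ∂(RobinInverse.surface Ω₁)))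
    (bbar : ℝ) (hbbar : 0 < bbar) (hbbar' : bbar < lo * min 1 γ / CF)
    (b : RobinInverse.E M → ℝ) (hb : AEMeasurable b (volume.restrict Ω))
    (hb' : ∀ᵐ x ∂(volume.restrict Ω), 0 < b x ∧ b x < bbar)
    (f : RobinInverse.E M → ℝ) (hf : MemLp f ∞ (volume.restrict Ω))
    (z : RobinInverse.H1Tr Ω₁)
    (aStar : RobinInverse.E M → ℝ) (haStar : MemLp aStar 2 (volume.restrict Ω))
    (ρ : ℝ) (hρ : 0 < ρ) :
    -- the coefficient-to-solution operator is well defined on the admissible set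
    (∀ a ∈ RobinInverse.admissible Ω Ω₁ lo hi,
      ∃! u : RobinInverse.H1Tr Ω₁, RobinInverse.IsWeakSolution Ω₁ γ b f a u) ∧
    -- a minimizer exists, and any two minimizers agree as elements of `L²(Ω)`
    ∃ a ∈ RobinInverse.admissible Ω Ω₁ lo hi,
      IsMinOn (RobinInverse.tikhonov Ω Ω₁ γ b f z ρ aStar)
        (RobinInverse.admissible Ω Ω₁ lo hi) a ∧
      ∀ a' ∈ RobinInverse.admissible Ω Ω₁ lo hi,
        IsMinOn (RobinInverse.tikhonov Ω Ω₁ γ b f z ρ aStar)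
          (RobinInverse.admissible Ω Ω₁ lo hi) a' →
        a' =ᵐ[volume.restrict Ω] a := by

  have : IsFiniteMeasure ((volume : Measure (RobinInverse.E M)).restrict Ω) :=
    ⟨by simpa using hΩb.measure_lt_top⟩
  have : IsFiniteMeasure ((volume : Measure (RobinInverse.E M)).restrict Ω₁) :=
    ⟨by simpa using (hΩb.subset hsub).measure_lt_top⟩
  have : IsFiniteMeasure (RobinInverse.surface Ω₁) :=
    RobinInverse.isFiniteMeasure_surface hM.le hΩ₁ (hΩb.subset hsub) hLip
  obtain ⟨z, rfl⟩ := (RobinInverse.traceGraphEquiv Ω₁).surjective z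
  have hle := Measure.restrict_mono_set (volume : Measure (RobinInverse.E M)) hsub
  have hb1 := ae_restrict_of_ae_restrict_of_subset hsub hb'
  have hbL : MemLp b ⊤ (volume.restrict Ω₁) :=
    memLp_of_bounded (a := 0) (b := bbar) (hb1.mono fun x hx => ⟨hx.1.le, hx.2.le⟩)
      (hb.mono_measure hle).aestronglyMeasurable ⊤
  have hfL : MemLp f 2 (volume.restrict Ω₁) := (hf.mono_measure hle).mono_exponent le_top
  rw [RobinInverse.admissible_eq]
  have c1 := RobinInverse.boundedCoefficients_mono (lo := lo) (hi := hi)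
    (RobinInverse.restrict_absolutelyContinuous_add hsub)
  have c2 := RobinInverse.boundedCoefficients_mono (lo := lo) (hi := hi)
    (RobinInverse.surface_absolutelyContinuous_add Ω Ω₁)
  have hcoer : ∀ a (ha : a ∈ RobinInverse.boundedCoefficients
      (volume.restrict Ω + RobinInverse.surface Ω₁) lo hi), IsCoercive
      (RobinInverse.robinForm Ω₁ γ
        (RobinInverse.memLp_of_mem_boundedCoefficients (c1 ha) ⊤).toLp
        (RobinInverse.memLp_of_mem_boundedCoefficients (c2 ha) ⊤).toLp hbL.toLp) :=
    fun a ha => RobinInverse.isCoercive_robinForm hlo hγ hCF hbbar hbbar' hFriedrichs _ _ _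
      ((c1 ha).2.mono fun x hx => hx.1) ((c2 ha).2.mono fun x hx => hx.1)
      (hb1.mono fun x hx => hx.2.le)
  refine ⟨fun a ha => RobinInverse.existsUnique_isWeakSolution _ _ _ hfL (hcoer a ha), ?_⟩
  have hJ : ∀ a ∈ RobinInverse.boundedCoefficients
      (volume.restrict Ω + RobinInverse.surface Ω₁) lo hi,
      IsGreatest (range fun v => RobinInverse.tikhonovMinorant Ω Ω₁ γ b f z ρ aStar v a)
        (RobinInverse.tikhonov Ω Ω₁ γ b f (RobinInverse.traceGraphEquiv Ω₁ z) ρ aStar a) := by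
    intro a ha
    obtain ⟨⟨u, hu⟩, hub⟩ := RobinInverse.G_isGreatest _ _ _ hfL (hcoer a ha) z
    refine ⟨⟨u, congrArg (· + _) hu⟩, ?_⟩
    rintro _ ⟨v, rfl⟩
    exact add_le_add_left (hub ⟨v, rfl⟩) _
  obtain ⟨a, ha, hmin⟩ := RobinInverse.exists_isMinOn_of_isGreatest hlohi.le (c₀ := 0) hJ
    (fun a ha => by
      -- the minorant at `z` itself is the penalty alone
      refine le_trans ?_ ((hJ a ha).2 ⟨z, rfl⟩)
      simp only [RobinInverse.tikhonovMinorant, RobinInverse.affineMinorant_self, zero_add]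
      exact mul_nonneg hρ.le (integral_nonneg fun x => sq_nonneg _))
    (fun v a a' h => RobinInverse.tikhonovMinorant_congr hsub γ b f z ρ aStar v h)
    (fun v => RobinInverse.convexOn_tikhonovMinorant hsub γ b f z hρ haStar v)
    (fun v a a' h hlim => RobinInverse.tikhonovMinorant_tendsto hsub γ b f z ρ haStar v h hlim)
  exact ⟨a, ha, hmin, fun a' ha' hmin' =>
    RobinInverse.ae_eq_of_isMinOn hsub hρ haStar hJ ha ha' hmin hmin'⟩
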